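/- Let $G$ be a countably infinite torsion Abelian group which is unbounded, i.e. there is no integer $n\ge 1$ with $ng=0$ for all $g\in G$. Then $G$ admits a complete Hausdorff group topology $\tau$ such that $(G,\tau)$ is minimally almost periodic, i.e. every continuous homomorphism from $(G,\tau)$ to the unit circle $\mathbb{T}$ is trivial (equivalently, the von Neumann radical $\mathbf{n}(G,\tau)=\bigcap_{\chi}\ker\chi$, where $\chi$ runs over all continuous characters of $(G,\tau)$, is all of $G$). Here complete means complete in the canonical uniformity of the topological group $(G,\tau)$. -/

import Mathlib

/-- The von Neumann radical `n(G)` of an Abelian topological group `G`: the intersection of the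
kernels of all continuous characters of `G`, i.e. of all continuous homomorphisms from `G` to the
unit circle. -/
def vonNeumannRadical (G : Type*) [AddCommGroup G] [TopologicalSpace G] : AddSubgroup G where
  carrier := {x | ∀ χ : AddChar G Circle, Continuous χ → χ x = 1}
  zero_mem' := fun χ _ => χ.map_zero_eq_one
  add_mem' := fun {x y} hx hy χ hχ => by rw [AddChar.map_add_eq_mul, hx χ hχ, hy χ hχ, mul_one]
  neg_mem' := fun {x} hx χ hχ => by rw [AddChar.map_neg_eq_inv, hx χ hχ, inv_one]

/-- An Abelian topological group `G` is minimally almost periodic if `n(G) = G`. -/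
def IsMinAP (G : Type*) [AddCommGroup G] [TopologicalSpace G] : Prop :=
  vonNeumannRadical G = ⊤

/-- An Abelian topological group is complete if it is complete in its canonical group uniformity
(the entourages being `{(x, y) | y - x ∈ U}`, for `U` a neighbourhood of `0`). -/
def IsCompleteTopAddGroup (G : Type*) [AddCommGroup G] [TopologicalSpace G]
    [IsTopologicalAddGroup G] : Prop :=
  @CompleteSpace G (IsTopologicalAddGroup.rightUniformSpace G)

/-! Take the finest group topology in which a well-chosen family of tails `E m` shrinks to `0`. It
is Hausdorff as soon as no nonzero element is, for some fixed `k`, a sum of `k` terms from every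
tail. Countability then makes it complete, since one basic neighbourhood can be built against a
Cauchy filter without limit, one element of the group at a time
(`IsTailSystem.exists_complete_topology`).

The tails are unions of finite blocks, one for each entry of a list that repeats every `g`
infinitely often. The block of `g` consists of `0`, the elements `±2 ^ j • d` with `j ≤ J`, and `±(g
+ t • d)`. A character close to `1` on the block is close to `1` at `t • d`, by binary expansion of
`t`, hence at `g`; so a continuous character is trivial. Unboundedness gives `d` large order modulo
the finite subgroup generated so far. A count gives a `t` whose small multiples are not sums of few
signed powers of two. Short sums of the block then avoid the earlier subgroup except at `0`
(`exists_block`), and this yields the separation condition. -/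

open scoped Pointwise Topology

/-! ### The finest group topology in which given tails converge to zero -/

section TailTopology

variable {G : Type*} [AddCommGroup G]

/-- The partial sums `E (n 0) + ⋯ + E (n (k - 1))`. -/
def tailSum (E : ℕ → Set G) (n : ℕ → ℕ) : ℕ → Set G
  | 0 => {0}
  | k + 1 => tailSum E n k + E (n k)

/-- The union of all partial sums `E (n 0) + ⋯ + E (n (k - 1))`. -/
def tailNhd (E : ℕ → Set G) (n : ℕ → ℕ) : Set G := ⋃ k, tailSum E n k

/-- A decreasing sequence of symmetric sets containing `0`, which differ by finite sets: the tails
of a null sequence, up to repetition of terms. -/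
structure IsTailSystem (E : ℕ → Set G) : Prop where
  anti : Antitone E
  zero_mem : ∀ m, (0 : G) ∈ E m
  neg_mem : ∀ m, ∀ x ∈ E m, -x ∈ E m
  finite_diff : ∀ m l, (E m \ E l).Finite

/-- The finite sums of tails. -/
inductive IsTailSum (E : ℕ → Set G) : Set G → Prop
  | zero : IsTailSum E {0}
  | add {S : Set G} (m : ℕ) : IsTailSum E S → IsTailSum E (S + E m)

namespace IsTailSystem

variable {E : ℕ → Set G}

lemma tailSum_mono (hE : IsTailSystem E) (n : ℕ → ℕ) : Monotone (tailSum E n) := by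
  refine monotone_nat_of_le_succ fun k x hx => ?_
  exact ⟨x, hx, 0, hE.zero_mem _, add_zero x⟩

lemma tailSum_anti (hE : IsTailSystem E) {n m : ℕ → ℕ} (h : n ≤ m) (k : ℕ) :
    tailSum E m k ⊆ tailSum E n k := by
  induction k with
  | zero => exact subset_rfl
  | succ k ih => exact Set.add_subset_add ih (hE.anti (h k))

lemma tailNhd_anti (hE : IsTailSystem E) {n m : ℕ → ℕ} (h : n ≤ m) :
    tailNhd E m ⊆ tailNhd E n :=
  Set.iUnion_mono fun k => hE.tailSum_anti h k

lemma neg_mem_tailSum (hE : IsTailSystem E) (n : ℕ → ℕ) (k : ℕ) :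
    ∀ x ∈ tailSum E n k, -x ∈ tailSum E n k := by
  induction k with
  | zero =>
    intro x hx
    rw [tailSum, Set.mem_singleton_iff] at hx ⊢
    rw [hx, neg_zero]
  | succ k ih =>
    rintro _ ⟨x, hx, y, hy, rfl⟩
    exact ⟨-x, ih x hx, -y, hE.neg_mem _ y hy, (neg_add x y).symm⟩

/-- The two summands from `E (m k)` go into the slots `2 * k` and `2 * k + 1` of `n`. This gives
continuity of addition. -/
lemma tailSum_add_tailSum (hE : IsTailSystem E) {n m : ℕ → ℕ}
    (h₀ : ∀ k, n (2 * k) ≤ m k) (h₁ : ∀ k, n (2 * k + 1) ≤ m k) (k : ℕ) :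
    tailSum E m k + tailSum E m k ⊆ tailSum E n (2 * k) := by
  induction k with
  | zero => simp [tailSum]
  | succ k ih =>
    rintro _ ⟨_, ⟨x, hx, y, hy, rfl⟩, _, ⟨x', hx', y', hy', rfl⟩, rfl⟩
    refine ⟨x + x' + y, ⟨x + x', ih ⟨x, hx, x', hx', rfl⟩, y, hE.anti (h₀ k) hy, rfl⟩, y',
      hE.anti (h₁ k) hy', ?_⟩
    simp only
    abel

lemma subset_tailNhd (n : ℕ → ℕ) : E (n 0) ⊆ tailNhd E n := by
  intro x hx
  exact Set.mem_iUnion.2 ⟨1, 0, rfl, x, hx, zero_add x⟩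

lemma zero_mem_tailNhd (n : ℕ → ℕ) : (0 : G) ∈ tailNhd E n :=
  Set.mem_iUnion.2 ⟨0, rfl⟩

/-- The filter basis at `0` of the finest group topology in which the tails `E m` converge
to `0`. -/
@[reducible] def filterBasis (hE : IsTailSystem E) : AddGroupFilterBasis G where
  sets := Set.range (tailNhd E)
  nonempty := Set.range_nonempty _
  inter_sets := by
    rintro _ _ ⟨n, rfl⟩ ⟨m, rfl⟩
    exact ⟨_, ⟨n ⊔ m, rfl⟩, Set.subset_inter (hE.tailNhd_anti le_sup_left)
      (hE.tailNhd_anti le_sup_right)⟩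
  zero' := by
    rintro _ ⟨n, rfl⟩
    exact zero_mem_tailNhd n
  add' := by
    rintro _ ⟨n, rfl⟩
    refine ⟨_, ⟨fun k => n (2 * k) ⊔ n (2 * k + 1), rfl⟩, ?_⟩
    rintro _ ⟨x, hx, y, hy, rfl⟩
    obtain ⟨k, hk⟩ := Set.mem_iUnion.1 hx
    obtain ⟨l, hl⟩ := Set.mem_iUnion.1 hy
    exact Set.mem_iUnion.2 ⟨2 * (k ⊔ l), hE.tailSum_add_tailSum (fun _ => le_sup_left)
      (fun _ => le_sup_right) _ ⟨x, hE.tailSum_mono _ le_sup_left hk, y,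
        hE.tailSum_mono _ le_sup_right hl, rfl⟩⟩
  neg' := by
    rintro _ ⟨n, rfl⟩
    refine ⟨_, ⟨n, rfl⟩, fun x hx => ?_⟩
    obtain ⟨k, hk⟩ := Set.mem_iUnion.1 hx
    exact Set.mem_iUnion.2 ⟨k, hE.neg_mem_tailSum n k x hk⟩
  conj' := by
    rintro x _ ⟨n, rfl⟩
    refine ⟨_, ⟨n, rfl⟩, fun y hy => ?_⟩
    simpa using hy

/-- If no nonzero element is a sum of boundedly many elements of arbitrarily late tails, then an
element outside a finite sum of tails stays outside after adding boundedly many late elements. -/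
lemma exists_notMem_add_nsmul (hE : IsTailSystem E)
    (hsep : ∀ k : ℕ, ∀ g : G, g ≠ 0 → ∃ m, g ∉ k • E m) {S : Set G} (hS : IsTailSum E S) :
    ∀ g ∉ S, ∀ l : ℕ, ∃ m, g ∉ S + l • E m := by
  induction hS with
  | zero =>
    intro g hg l
    obtain ⟨m, hm⟩ := hsep l g hg
    refine ⟨m, ?_⟩
    rwa [Set.singleton_zero, zero_add]
  | @add S n _ ih =>
    intro g hg l
    have hgS : g ∉ S := fun h => hg ⟨g, h, 0, hE.zero_mem _, add_zero g⟩
    obtain ⟨m₀, hm₀⟩ := ih g hgS (l + 1)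
    -- Split on the summand `y ∈ E n`: if it lies in `E m₀` it counts as one more late term, hence
    -- `l + 1` above. Only finitely many other `y` remain, and each is handled by induction at `g -
    -- y`.
    have hy : ∀ y : G, ∃ m, y ∈ E n → g - y ∉ S + l • E m := by
      intro y
      by_cases hyn : y ∈ E n
      · obtain ⟨m, hm⟩ := ih (g - y) (fun h => hg ⟨g - y, h, y, hyn, sub_add_cancel g y⟩) l
        exact ⟨m, fun _ => hm⟩
      · exact ⟨0, fun h => absurd h hyn⟩
    choose μ hμ using hy
    obtain ⟨b, hb⟩ := ((hE.finite_diff n m₀).image μ).bddAbove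
    refine ⟨m₀ ⊔ b, ?_⟩
    rintro ⟨_, ⟨s, hs, y, hyn, rfl⟩, e, he, rfl⟩
    by_cases hym : y ∈ E m₀
    · refine hm₀ ⟨s, hs, e + y, ?_, by simp only; abel⟩
      rw [succ_nsmul]
      exact ⟨e, Set.nsmul_subset_nsmul_left (hE.anti le_sup_left) he, y, hym, rfl⟩
    · refine hμ y hyn ⟨s, hs, e, Set.nsmul_subset_nsmul_left (hE.anti ?_) he, ?_⟩
      · exact (hb ⟨y, ⟨hyn, hym⟩, rfl⟩).trans le_sup_right
      · simp only; abel

/-- The indices are chosen greedily, each keeping `g` outside the next partial sum. -/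
lemma exists_notMem_tailNhd (hE : IsTailSystem E)
    (hsep : ∀ k : ℕ, ∀ g : G, g ≠ 0 → ∃ m, g ∉ k • E m) {g : G} (hg : g ≠ 0) :
    ∃ n, g ∉ tailNhd E n := by
  have step : ∀ S : {S : Set G // IsTailSum E S ∧ g ∉ S}, ∃ m, g ∉ S.1 + E m := by
    rintro ⟨S, hS, hgS⟩
    simpa using hE.exists_notMem_add_nsmul hsep hS g hgS 1
  choose μ hμ using step
  let T : ℕ → {S : Set G // IsTailSum E S ∧ g ∉ S} := fun k =>
    Nat.rec ⟨{0}, .zero, hg⟩ (fun _ S => ⟨S.1 + E (μ S), S.2.1.add _, hμ S⟩) k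
  have hT : ∀ k, tailSum E (fun k => μ (T k)) k = (T k).1 := by
    intro k
    induction k with
    | zero => rfl
    | succ k ih => rw [tailSum, ih]
  refine ⟨fun k => μ (T k), fun h => ?_⟩
  obtain ⟨k, hk⟩ := Set.mem_iUnion.1 h
  rw [hT] at hk
  exact (T k).2.2 hk

/-- An ultrafilter on `E m` either contains every tail and tends to `0`, or contains a finite set
and is principal. -/
lemma isCompact_of_nhds_zero (hE : IsTailSystem E) [TopologicalSpace G]
    (h : ∀ U ∈ 𝓝 (0 : G), ∃ m, E m ⊆ U) (m : ℕ) : IsCompact (E m) := by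
  rw [isCompact_iff_ultrafilter_le_nhds]
  intro f hf
  by_cases hl : ∀ l, E l ∈ f
  · refine ⟨0, hE.zero_mem m, fun U hU => ?_⟩
    obtain ⟨l, hl'⟩ := h U hU
    exact Filter.mem_of_superset (hl l) hl'
  · push Not at hl
    obtain ⟨l, hl⟩ := hl
    have hmem : E m \ E l ∈ f :=
      Filter.inter_mem (Filter.le_principal_iff.1 hf) (Ultrafilter.compl_mem_iff_notMem.2 hl)
    obtain ⟨x, hx, rfl⟩ := Ultrafilter.eq_pure_of_finite_mem (hE.finite_diff m l) hmem
    exact ⟨x, hx.1, pure_le_nhds x⟩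

/-- A countable group whose neighbourhoods of `0` are the unions of partial sums of tails is
complete. -/
lemma isComplete (hE : IsTailSystem E) [Countable G] [TopologicalSpace G]
    [IsTopologicalAddGroup G] (h : ∀ U ∈ 𝓝 (0 : G), ∃ m, E m ⊆ U)
    (hnhd : ∀ n, tailNhd E n ∈ 𝓝 (0 : G)) : IsCompleteTopAddGroup G := by
  let _ : UniformSpace G := IsTopologicalAddGroup.rightUniformSpace G
  have _ : IsUniformAddGroup G := isUniformAddGroup_of_addCommGroup
  refine ⟨fun {f} hf => ?_⟩
  by_contra! hlim
  have hcl : ∀ x, Disjoint (𝓝 x) f := by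
    intro x
    by_contra hx
    exact hlim x (le_nhds_of_cauchy_adhp hf (Filter.neBot_iff.2 fun h0 => hx (disjoint_iff.2 h0)))
  have hcompact : ∀ K : Set G, IsCompact K → ∃ F ∈ f, IsClosed F ∧ Disjoint K F := by
    intro K hK
    obtain ⟨O, hO, hOf⟩ :=
      Filter.disjoint_iff.1 (hK.disjoint_nhdsSet_left.2 fun x _ => hcl x)
    obtain ⟨V, hV, hVf, hVO⟩ : ∃ V, IsOpen V ∧ K ⊆ V ∧ V ⊆ O := by
      obtain ⟨V, hV, h1, h2⟩ := mem_nhdsSet_iff_exists.1 hO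
      exact ⟨V, hV, h1, h2⟩
    obtain ⟨W, hW, hVW⟩ := hOf
    exact ⟨Vᶜ, Filter.mem_of_superset hW fun x hx hxV =>
      Set.disjoint_left.1 hVW (hVO hxV) hx, hV.isClosed_compl,
      Set.disjoint_compl_right_iff_subset.2 hVf⟩
  obtain ⟨e, he⟩ := exists_surjective_nat G
  -- A state pairs the current partial sum with a closed set that all later partial sums must avoid.
  -- Stage `k` adds to the latter a translate `F - e k` with `F ∈ f`.
  let State := {p : Set G × Set G // IsCompact p.1 ∧ IsClosed p.2 ∧ Disjoint p.1 p.2}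
  have step : ∀ (k : ℕ) (p : State), ∃ (m : ℕ) (q : State), q.1.1 = p.1.1 + E m ∧
      p.1.2 ⊆ q.1.2 ∧ ∃ F ∈ f, ∀ y ∈ F, y - e k ∈ q.1.2 := by
    rintro k ⟨⟨S, C⟩, hS, hC, hSC⟩
    obtain ⟨V, hV, hSV⟩ := compact_open_separated_add_right hS hC.isOpen_compl
      (Set.subset_compl_iff_disjoint_right.2 hSC)
    obtain ⟨m, hm⟩ := h V hV
    have hSm : IsCompact (S + E m) := hS.add (hE.isCompact_of_nhds_zero h m)
    obtain ⟨F, hF, hFc, hFS⟩ := hcompact ((fun x => x + e k) '' (S + E m))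
      (hSm.image (by fun_prop))
    refine ⟨m, ⟨⟨S + E m, C ∪ (fun x => x + e k) ⁻¹' F⟩, hSm,
      hC.union (hFc.preimage (by fun_prop)), ?_⟩, rfl, Set.subset_union_left, F, hF, ?_⟩
    · refine Set.disjoint_union_right.2 ⟨?_, ?_⟩
      · exact Set.subset_compl_iff_disjoint_right.1
          ((Set.add_subset_add_left hm).trans hSV)
      · rw [Set.disjoint_left]
        intro x hx hxF
        exact Set.disjoint_left.1 hFS ⟨x, hx, rfl⟩ hxF
    · intro y hy
      right
      simpa using hy
  choose μ next hnext hsub hF using step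
  have hstart : IsCompact ({0} : Set G) ∧ IsClosed (∅ : Set G) ∧ Disjoint ({0} : Set G) ∅ :=
    ⟨isCompact_singleton, isClosed_empty, Set.disjoint_empty _⟩
  let T : ℕ → State := fun k => Nat.rec ⟨⟨{0}, ∅⟩, hstart⟩ (fun k p => next k p) k
  have hT : ∀ k, tailSum E (fun k => μ k (T k)) k = (T k).1.1 := by
    intro k
    induction k with
    | zero => rfl
    | succ k ih => rw [tailSum, ih]; exact (hnext k (T k)).symm
  have hTmono : Monotone fun k => (T k).1.2 := monotone_nat_of_le_succ fun k => hsub k (T k)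
  have hU := hnhd fun k => μ k (T k)
  obtain ⟨F, hFf, hFU⟩ := (cauchy_iff.1 hf).2 _
    (by rw [uniformity_eq_comap_nhds_zero G]; exact Filter.preimage_mem_comap hU)
  obtain ⟨x, hx⟩ := hf.1.nonempty_of_mem hFf
  obtain ⟨j, rfl⟩ := he x
  obtain ⟨F', hF'f, hF'⟩ := hF j (T j)
  obtain ⟨y, hy, hy'⟩ := hf.1.nonempty_of_mem (Filter.inter_mem hFf hF'f)
  have hyU : y - e j ∈ tailNhd E fun k => μ k (T k) := hFU (Set.mk_mem_prod hx hy)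
  obtain ⟨k, hk⟩ := Set.mem_iUnion.1 hyU
  -- The translate by `e j` is avoided only from stage `j + 1` on, so both memberships are moved to
  -- a common later stage.
  have hk' := hE.tailSum_mono _ (le_max_left k (j + 1)) hk
  rw [hT] at hk'
  exact Set.disjoint_left.1 (T (max k (j + 1))).2.2.2 hk'
    (hTmono (le_max_right k (j + 1)) (hF' y hy'))

/-- A countable Abelian group carries a complete Hausdorff group topology in which the tails `E m`
converge to `0`, provided no nonzero element is a sum of boundedly many arbitrarily late terms. -/
theorem exists_complete_topology (hE : IsTailSystem E) [Countable G]
    (hsep : ∀ k : ℕ, ∀ g : G, g ≠ 0 → ∃ m, g ∉ k • E m) :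
    ∃ (_ : TopologicalSpace G) (_ : IsTopologicalAddGroup G),
      T2Space G ∧ IsCompleteTopAddGroup G ∧ ∀ U ∈ 𝓝 (0 : G), ∃ m, E m ⊆ U := by
  let τ : TopologicalSpace G := hE.filterBasis.topology
  have hτ : IsTopologicalAddGroup G := hE.filterBasis.isTopologicalAddGroup
  have hbasis := hE.filterBasis.nhds_zero_hasBasis
  have hnhd : ∀ n, tailNhd E n ∈ 𝓝 (0 : G) := fun n => hbasis.mem_of_mem ⟨n, rfl⟩
  have htail : ∀ U ∈ 𝓝 (0 : G), ∃ m, E m ⊆ U := by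
    intro U hU
    obtain ⟨_, ⟨n, rfl⟩, hn⟩ := hbasis.mem_iff.1 hU
    exact ⟨n 0, (subset_tailNhd n).trans hn⟩
  refine ⟨τ, hτ, ?_, hE.isComplete htail hnhd, htail⟩
  refine IsTopologicalAddGroup.t2Space_of_zero_sep fun g hg => ?_
  obtain ⟨n, hn⟩ := hE.exists_notMem_tailNhd hsep hg
  exact ⟨_, hnhd n, hn⟩

end IsTailSystem

end TailTopology

/-! ### Signed powers of two and characters -/

section Blocks

/-- The signed powers of two `±2 ^ j` with `j ≤ J`, together with `0`. -/
def signedPowers (J : ℕ) : Finset ℤ :=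
  insert 0 ((Finset.range (J + 1)).image (fun j => (2 : ℤ) ^ j) ∪
    (Finset.range (J + 1)).image fun j => -(2 : ℤ) ^ j)

lemma mem_signedPowers {J : ℕ} {p : ℤ} :
    p ∈ signedPowers J ↔ p = 0 ∨ ∃ j ≤ J, p = 2 ^ j ∨ p = -2 ^ j := by
  simp only [signedPowers, Finset.mem_insert, Finset.mem_union, Finset.mem_image,
    Finset.mem_range, Nat.lt_succ_iff]
  grind

lemma card_signedPowers_le (J : ℕ) : (signedPowers J).card ≤ 2 * J + 3 := by
  refine (Finset.card_insert_le _ _).trans ?_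
  have h := Finset.card_union_le ((Finset.range (J + 1)).image (fun j => (2 : ℤ) ^ j))
    ((Finset.range (J + 1)).image fun j => -(2 : ℤ) ^ j)
  have h₁ := Finset.card_image_le (s := Finset.range (J + 1)) (f := fun j => (2 : ℤ) ^ j)
  have h₂ := Finset.card_image_le (s := Finset.range (J + 1)) (f := fun j => -(2 : ℤ) ^ j)
  rw [Finset.card_range] at h₁ h₂
  omega

lemma abs_le_of_mem_nsmul_signedPowers {J : ℕ} (n : ℕ) :
    ∀ p ∈ n • signedPowers J, |p| ≤ n * 2 ^ J := by
  induction n with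
  | zero => intro p hp; simpa using hp
  | succ n ih =>
    intro p hp
    rw [succ_nsmul, Finset.mem_add] at hp
    obtain ⟨x, hx, y, hy, rfl⟩ := hp
    have hy' : |y| ≤ 2 ^ J := by
      obtain rfl | ⟨j, hj, rfl | rfl⟩ := mem_signedPowers.1 hy
      · simp
      · rw [abs_of_nonneg (by positivity)]
        exact pow_le_pow_right₀ (by norm_num) hj
      · rw [abs_neg, abs_of_nonneg (by positivity)]
        exact pow_le_pow_right₀ (by norm_num) hj
    have := abs_add_le x y
    have := ih x hx
    push_cast
    linarith

/-- The left side bounds the number of pairs of a coefficient `|c| ≤ n` and a sum of `n` signed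
powers. It is polynomial in `J`. -/
lemma exists_mul_pow_lt_two_pow (n : ℕ) :
    ∃ J : ℕ, (2 * n + 1) * (2 * J + 3) ^ n < 2 ^ (J + 1) := by
  have h := tendsto_pow_const_div_const_pow_of_one_lt n (one_lt_two : (1 : ℝ) < 2)
  have hC : (0 : ℝ) < 1 / ((2 * n + 1) * 5 ^ n) := by positivity
  obtain ⟨J, hJ, hJ1⟩ := ((h.eventually_lt_const hC).and (Filter.eventually_ge_atTop 1)).exists
  refine ⟨J, ?_⟩
  rw [div_lt_div_iff₀ (by positivity) (by positivity)] at hJ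
  have h1 : (2 * n + 1) * (2 * J + 3) ^ n ≤ (2 * n + 1) * (5 * J) ^ n := by
    gcongr
    omega
  have h2 : (2 * n + 1) * (5 * J) ^ n < 2 ^ J := by
    have : ((2 * n + 1) * (5 * J) ^ n : ℝ) < 2 ^ J := by
      rw [mul_pow]
      linarith
    exact_mod_cast this
  have h3 : 2 ^ J ≤ 2 ^ (J + 1) := Nat.pow_le_pow_right (by norm_num) (by omega)
  omega

/-- Some `t < 2 ^ (J + 1)` is such that no small nonzero multiple of it is a sum of few signed
powers of two. -/
lemma exists_forall_mul_notMem_nsmul_signedPowers (n : ℕ) :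
    ∃ J t : ℕ, t < 2 ^ (J + 1) ∧
      ∀ c : ℤ, c ≠ 0 → |c| ≤ n → c * t ∉ n • signedPowers J := by
  obtain ⟨J, hJ⟩ := exists_mul_pow_lt_two_pow n
  refine ⟨J, ?_⟩
  -- Otherwise every `t < 2 ^ (J + 1)` is a quotient `p / c` of such a pair, and there are too few
  -- pairs.
  by_contra! hcon
  have hsub : (Finset.range (2 ^ (J + 1))).image (fun t : ℕ => (t : ℤ)) ⊆
      (Finset.Icc (-n : ℤ) n ×ˢ (n • signedPowers J)).image fun q => q.2 / q.1 := by
    intro s hs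
    obtain ⟨t, ht, rfl⟩ := Finset.mem_image.1 hs
    obtain ⟨c, hc, hcn, hmem⟩ := hcon t (Finset.mem_range.1 ht)
    refine Finset.mem_image.2 ⟨(c, c * t), ?_, Int.mul_ediv_cancel_left _ hc⟩
    exact Finset.mem_product.2 ⟨Finset.mem_Icc.2 (abs_le.1 hcn), hmem⟩
  have h1 := Finset.card_le_card hsub
  rw [Finset.card_image_of_injective _ Nat.cast_injective, Finset.card_range] at h1
  have h2 := h1.trans Finset.card_image_le
  rw [Finset.card_product, Int.card_Icc] at h2
  have h3 : (n • signedPowers J).card ≤ (2 * J + 3) ^ n :=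
    Finset.card_nsmul_le.trans (Nat.pow_le_pow_left (card_signedPowers_le J) n)
  have h4 : ((n : ℤ) + 1 - -n).toNat = 2 * n + 1 := by omega
  rw [h4] at h2
  have h5 := Nat.mul_le_mul_left (2 * n + 1) h3
  omega

/-- If all `z ^ (2 ^ j)`, `j ≤ J`, are close to `1`, then so are all `z ^ t`, `t < 2 ^ (J + 1)`. -/
lemma norm_pow_sub_one_le {z : ℂ} (hz : ‖z‖ = 1) (J : ℕ)
    (h : ∀ j ≤ J, ‖z ^ 2 ^ j - 1‖ ≤ 1 / 2) :
    ∀ t < 2 ^ (J + 1), ‖z ^ t - 1‖ ≤ 3 * ‖z ^ 2 ^ J - 1‖ := by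
  induction J with
  | zero =>
    intro t ht
    have := norm_nonneg (z - 1)
    obtain rfl | rfl : t = 0 ∨ t = 1 := by omega
    · simp
    · simp only [pow_one, pow_zero]
      linarith
  | succ J ih =>
    have ih' := ih fun j hj => h j (by omega)
    set w := z ^ 2 ^ J with hw
    have hw2 : z ^ 2 ^ (J + 1) = w ^ 2 := by rw [hw, ← pow_mul, pow_succ]
    -- Hence `3 * ‖w - 1‖ ≤ 2 * ‖w ^ 2 - 1‖`, which leaves room for the top binary digit; this is
    -- why the constant `3` reproduces itself.
    have hdouble : 3 / 2 * ‖w - 1‖ ≤ ‖w ^ 2 - 1‖ := by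
      have h1 : w ^ 2 - 1 = (w - 1) * (w + 1) := by ring
      have h2 : 3 / 2 ≤ ‖w + 1‖ := by
        have h3 : (2 : ℂ) = (w + 1) - (w - 1) := by ring
        have h4 := norm_sub_le (w + 1) (w - 1)
        rw [← h3, Complex.norm_ofNat] at h4
        have h5 : ‖w - 1‖ ≤ 1 / 2 := h J (by omega)
        linarith
      rw [h1, norm_mul, mul_comm]
      gcongr
    intro t ht
    rw [hw2]
    by_cases hlt : t < 2 ^ (J + 1)
    · have := ih' t hlt
      have := norm_nonneg (w - 1)
      linarith
    · obtain ⟨s, rfl⟩ := Nat.exists_eq_add_of_le (not_lt.1 hlt)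
      have hs : s < 2 ^ (J + 1) := by rw [pow_succ 2 (J + 1)] at ht; omega
      have h1 : z ^ (2 ^ (J + 1) + s) - 1 = w ^ 2 * (z ^ s - 1) + (w ^ 2 - 1) := by
        rw [pow_add, hw2]; ring
      have hwn : ‖w ^ 2‖ = 1 := by rw [hw, norm_pow, norm_pow, hz, one_pow, one_pow]
      have h2 := norm_add_le (w ^ 2 * (z ^ s - 1)) (w ^ 2 - 1)
      rw [norm_mul, hwn, one_mul] at h2
      rw [h1]
      have := ih' s hs
      linarith

/-! ### Construction of the blocks and of the tail system -/

variable {G : Type*} [AddCommGroup G]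

/-- In an unbounded group there are elements of arbitrarily large order modulo a given finite
subgroup. -/
lemma exists_forall_zsmul_mem_imp_eq_zero (hunb : AddMonoid.exponent G = 0) (F : AddSubgroup G)
    [Finite F] (N : ℕ) : ∃ d : G, ∀ a : ℤ, |a| < N → a • d ∈ F → a = 0 := by
  by_contra! hcon
  refine AddMonoid.exponent_eq_zero_iff.1 hunb
    -- A nonzero `a` with `|a| < N` divides `N!`, so `N!` sends every `d` into `F`, which its order
    -- kills.
    ⟨N.factorial * Nat.card F, Nat.mul_pos N.factorial_pos Nat.card_pos, fun d => ?_⟩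
  obtain ⟨a, haN, had, ha⟩ := hcon d
  have hdvd : a ∣ (N.factorial : ℤ) := by
    rw [← Int.natAbs_dvd]
    exact_mod_cast Nat.dvd_factorial (Int.natAbs_pos.2 ha)
      (by rw [Int.abs_eq_natAbs] at haN; omega)
  obtain ⟨b, hb⟩ := hdvd
  have hmem : N.factorial • d ∈ F := by
    rw [← natCast_zsmul, hb, mul_comm, mul_zsmul]
    exact F.zsmul_mem had b
  rw [mul_comm, mul_nsmul']
  have := card_nsmul_eq_zero' (x := (⟨_, hmem⟩ : F))
  exact congrArg Subtype.val this

lemma finite_closure_of_isAddTorsion (htors : IsAddTorsion G) {s : Set G} (hs : s.Finite) :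
    Finite (AddSubgroup.closure s) := by
  have : Finite s := hs
  exact AddCommGroup.finite_of_fg_isAddTorsion _ (htors.addSubgroup _)

/-- A finite symmetric set `B`, short sums of which meet `F` only in `0`, such that a character
close to `1` on `B` is close to `1` at `g`. -/
lemma exists_block (hunb : AddMonoid.exponent G = 0) (htors : IsAddTorsion G) (F : AddSubgroup G)
    [Finite F] (g : G) (n : ℕ) :
    ∃ B : Set G, B.Finite ∧ 0 ∈ B ∧ (∀ x ∈ B, -x ∈ B) ∧ (∀ b ∈ n • B, b ∈ F → b = 0) ∧
      ∀ (χ : AddChar G Circle) (ε : ℝ), ε ≤ 1 / 2 → (∀ x ∈ B, ‖(χ x : ℂ) - 1‖ ≤ ε) →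
        ‖(χ g : ℂ) - 1‖ ≤ 4 * ε := by
  obtain ⟨J, t, htJ, ht⟩ := exists_forall_mul_notMem_nsmul_signedPowers n
  have _ : Finite (AddSubgroup.closure (insert g F : Set G)) :=
    finite_closure_of_isAddTorsion htors ((Set.toFinite _).insert g)
  have hsub := AddSubgroup.subset_closure (k := (insert g F : Set G))
  -- Working modulo `g` as well as `F` isolates the coefficient `p + c * t` of `d` in a short sum;
  -- the bound exceeds its absolute value.
  obtain ⟨d, hd⟩ := exists_forall_zsmul_mem_imp_eq_zero hunb
    (AddSubgroup.closure (insert g F : Set G))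
    (n * 2 ^ J + n * t + 1)
  let C : Set G := {g + t • d, -(g + t • d)}
  refine ⟨(fun p : ℤ => p • d) '' (signedPowers J) ∪ C, ?_, ?_, ?_, ?_, ?_⟩
  · exact ((signedPowers J).finite_toSet.image _).union (Set.toFinite _)
  · exact Or.inl ⟨0, mem_signedPowers.2 (Or.inl rfl), zero_zsmul d⟩
  · rintro x (⟨p, hp, rfl⟩ | rfl | rfl)
    · refine Or.inl ⟨-p, mem_signedPowers.2 ?_, neg_zsmul d p⟩
      have := mem_signedPowers.1 hp
      grind
    · exact Or.inr (Or.inr rfl)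
    · exact Or.inr (Or.inl (neg_neg _))
  · have hform : ∀ k : ℕ, ∀ b ∈ k • ((fun p : ℤ => p • d) '' (signedPowers J) ∪ C),
        ∃ p ∈ k • signedPowers J, ∃ c : ℤ, |c| ≤ k ∧ b = p • d + c • (g + t • d) := by
      intro k
      induction k with
      | zero =>
        intro b hb
        rw [zero_nsmul] at hb
        exact ⟨0, by simp, 0, by simp, by simpa using hb⟩
      | succ k ih =>
        intro b hb
        rw [succ_nsmul] at hb
        obtain ⟨x, hx, y, hy, rfl⟩ := hb
        obtain ⟨p, hp, c, hc, rfl⟩ := ih x hx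
        have h0 : (0 : ℤ) ∈ signedPowers J := mem_signedPowers.2 (Or.inl rfl)
        simp only [succ_nsmul, Finset.mem_add]
        obtain ⟨q, hq, rfl⟩ | rfl | rfl := hy
        · refine ⟨p + q, ⟨p, hp, q, hq, rfl⟩, c, by push_cast; omega, ?_⟩
          simp only [add_zsmul]; abel
        · refine ⟨p + 0, ⟨p, hp, 0, h0, rfl⟩, c + 1, by push_cast; grind, ?_⟩
          simp only [add_zsmul, one_zsmul, zero_zsmul]; abel
        · refine ⟨p + 0, ⟨p, hp, 0, h0, rfl⟩, c - 1, by push_cast; grind, ?_⟩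
          simp only [add_zsmul, sub_zsmul, one_zsmul, zero_zsmul]; abel
    intro b hb hbF
    obtain ⟨p, hp, c, hc, rfl⟩ := hform n b hb
    have hmem : (p + c * t) • d ∈ AddSubgroup.closure (insert g F : Set G) := by
      have h1 : (p + c * t) • d = (p • d + c • (g + t • d)) - c • g := by
        rw [add_zsmul, mul_comm c, mul_zsmul', natCast_zsmul, zsmul_add]
        abel
      rw [h1]
      exact sub_mem (hsub (Or.inr hbF)) (zsmul_mem (hsub (Or.inl rfl)) c)
    have hzero : p + c * t = 0 := by
      refine hd _ ?_ hmem
      have h1 := abs_le_of_mem_nsmul_signedPowers n p hp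
      have h2 := abs_add_le p (c * t)
      have h3 : |c * (t : ℤ)| ≤ n * t := by
        rw [abs_mul, Nat.abs_cast]
        gcongr
      push_cast
      linarith
    -- Now `p = -c * t` is a sum of `n` signed powers, which the choice of `t` forbids unless `c =
    -- 0`.
    by_cases hc0 : c = 0
    · subst hc0
      have : p = 0 := by simpa using hzero
      simp [this]
    · refine absurd ?_ (ht (-c) (neg_ne_zero.2 hc0) (by rwa [abs_neg]))
      rwa [show -c * (t : ℤ) = p by linarith]
  · intro χ ε hε hχ
    have hpow : ∀ j ≤ J, ‖((χ d : Circle) : ℂ) ^ 2 ^ j - 1‖ ≤ ε := by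
      intro j hj
      have := hχ (((2 : ℤ) ^ j) • d)
        (Or.inl ⟨2 ^ j, mem_signedPowers.2 (Or.inr ⟨j, hj, Or.inl rfl⟩), rfl⟩)
      have h2 : ((2 : ℤ) ^ j) • d = (2 ^ j : ℕ) • d := by
        rw [← natCast_zsmul]; push_cast; rfl
      rwa [h2, AddChar.map_nsmul_eq_pow, Circle.coe_pow] at this
    have h1 := norm_pow_sub_one_le (Circle.norm_coe (χ d)) J
      (fun j hj => (hpow j hj).trans hε) t htJ
    have h2 := hpow J le_rfl
    have h3 := hχ (g + t • d) (Or.inr (Or.inl rfl))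
    rw [AddChar.map_add_eq_mul, AddChar.map_nsmul_eq_pow, Circle.coe_mul, Circle.coe_pow] at h3
    set z : ℂ := (χ d : ℂ) ^ t with hz
    have hzn : ‖z‖ = 1 := by rw [hz, norm_pow, Circle.norm_coe, one_pow]
    have h4 : ‖(χ g : ℂ) - 1‖ = ‖((χ g : ℂ) * z - 1) - (z - 1)‖ := by
      rw [show ((χ g : ℂ) * z - 1) - (z - 1) = ((χ g : ℂ) - 1) * z by ring, norm_mul, hzn, mul_one]
    rw [h4]
    have h5 := norm_sub_le ((χ g : ℂ) * z - 1) (z - 1)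
    linarith

/-- Sums of late terms can be grouped by blocks. -/
lemma exists_sum_of_mem_nsmul_iUnion {B : ℕ → Set G} (h0 : ∀ i, (0 : G) ∈ B i) (m k : ℕ) :
    ∀ x ∈ k • ⋃ i ≥ m, B i, ∃ (s : Finset ℕ) (f : ℕ → G), (∀ i ∈ s, m ≤ i) ∧
      (∀ i, f i ∈ k • B i) ∧ (∀ i ∉ s, f i = 0) ∧ x = ∑ i ∈ s, f i := by
  induction k with
  | zero =>
    intro x hx
    exact ⟨∅, 0, by simp, by simp, by simp, by simpa using hx⟩
  | succ k ih =>
    intro x hx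
    rw [succ_nsmul] at hx
    obtain ⟨x, hx, y, hy, rfl⟩ := hx
    obtain ⟨s, f, hs, hf, hf0, rfl⟩ := ih x hx
    simp only [Set.mem_iUnion] at hy
    obtain ⟨i, hi, hy⟩ := hy
    refine ⟨insert i s, f + Pi.single i y, ?_, ?_, ?_, ?_⟩
    · intro j hj
      obtain rfl | hj := Finset.mem_insert.1 hj
      exacts [hi, hs j hj]
    · intro j
      rw [succ_nsmul]
      refine ⟨f j, hf j, (Pi.single i y : ℕ → G) j, ?_, rfl⟩
      by_cases hij : j = i
      · subst hij; simpa using hy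
      · simpa [hij] using h0 j
    · intro j hj
      rw [Finset.mem_insert, not_or] at hj
      simp [hj.1, hf0 j hj.2]
    · have hsingle : ∑ j ∈ insert i s, (Pi.single i y : ℕ → G) j = y := by
        rw [Finset.sum_eq_single_of_mem i (Finset.mem_insert_self i s) fun j _ hj => by simp [hj],
          Pi.single_eq_same]
      simp only [Pi.add_apply, Finset.sum_add_distrib, hsingle]
      rw [Finset.sum_insert_of_eq_zero_if_notMem (hf0 i)]

/-- If short sums of each block `B i` meet `F i` only in `0` and `B i ⊆ F (i + 1)`, then a sum of
elements of late blocks lying in an early `F m` vanishes. -/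
lemma sum_eq_zero_of_mem {F : ℕ → AddSubgroup G} (hF : Monotone F) {f : ℕ → G}
    (hf : ∀ i, f i ∈ F (i + 1)) (m : ℕ) (hf0 : ∀ i ≥ m, f i ∈ F i → f i = 0) (s : Finset ℕ) :
    (∀ i ∈ s, m ≤ i) → ∑ i ∈ s, f i ∈ F m → ∑ i ∈ s, f i = 0 := by
  induction s using Finset.induction_on_max with
  | empty => simp
  | insert M s hM ih =>
    intro hs hmem
    have hMs : M ∉ s := fun h => lt_irrefl M (hM M h)
    rw [Finset.sum_insert hMs] at hmem ⊢
    have hmM : m ≤ M := hs M (Finset.mem_insert_self M s)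
    have hrest : ∑ i ∈ s, f i ∈ F M := sum_mem fun i hi => hF (hM i hi) (hf i)
    -- The last term is the whole sum minus the earlier terms, so it lies in `F M`.
    have hfM : f M = 0 := by
      refine hf0 M hmM ?_
      have := sub_mem (hF hmM hmem) hrest
      rwa [add_sub_cancel_right] at this
    rw [hfM, zero_add] at hmem ⊢
    exact ih (fun i hi => hs i (Finset.mem_insert_of_mem hi)) hmem

/-- A countable unbounded torsion group has a tail system satisfying the separation condition of
`IsTailSystem.exists_complete_topology`, such that a character converging to `1` along the tails
is trivial. -/
theorem exists_isTailSystem_forall_addChar_eq_one [Countable G] (htors : IsAddTorsion G)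
    (hunb : AddMonoid.exponent G = 0) :
    ∃ E : ℕ → Set G, IsTailSystem E ∧ (∀ k : ℕ, ∀ g : G, g ≠ 0 → ∃ m, g ∉ k • E m) ∧
      ∀ χ : AddChar G Circle, (∀ ε > 0, ∃ m, ∀ x ∈ E m, ‖(χ x : ℂ) - 1‖ < ε) →
        ∀ g, χ g = 1 := by
  obtain ⟨e₀, he₀⟩ := exists_surjective_nat G
  -- Unpairing makes every element recur at arbitrarily late indices, so each tail controls
  -- characters at every `g`.
  let e : ℕ → G := fun n => e₀ n.unpair.1
  have he : ∀ (g : G) (m : ℕ), ∃ n ≥ m, e n = g := by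
    intro g m
    obtain ⟨a, rfl⟩ := he₀ g
    exact ⟨Nat.pair a m, Nat.right_le_pair a m, by simp [e]⟩
  have block := fun (F : {F : AddSubgroup G // Finite F}) (n : ℕ) =>
    have := F.2
    exists_block hunb htors F.1 (e n) n
  choose B hBfin hB0 hBneg hBF hBχ using block
  have hnext : ∀ (F : {F : AddSubgroup G // Finite F}) (n : ℕ),
      ∃ F' : {F : AddSubgroup G // Finite F}, F.1 ≤ F'.1 ∧ e n ∈ F'.1 ∧ B F n ⊆ F'.1 := by
    intro F n
    have hfin : (insert (e n) (B F n) ∪ F.1 : Set G).Finite :=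
      ((hBfin F n).insert _).union (have := F.2; Set.toFinite _)
    have hsub := AddSubgroup.subset_closure (k := (insert (e n) (B F n) ∪ F.1 : Set G))
    refine ⟨⟨AddSubgroup.closure (insert (e n) (B F n) ∪ F.1), ?_⟩, ?_, ?_, ?_⟩
    · exact finite_closure_of_isAddTorsion htors hfin
    · exact fun x hx => hsub (Or.inr hx)
    · exact hsub (Or.inl (Set.mem_insert _ _))
    · exact fun x hx => hsub (Or.inl (Set.mem_insert_of_mem _ hx))
  choose next hle he_mem hB_sub using hnext
  let F : ℕ → {F : AddSubgroup G // Finite F} := fun n =>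
    Nat.rec ⟨⊥, inferInstance⟩ (fun n F => next F n) n
  have hFmono : Monotone fun n => (F n).1 := monotone_nat_of_le_succ fun n => hle (F n) n
  have hmono : ∀ (k : ℕ) (i : ℕ), k ≤ i → k • B (F i) i ⊆ i • B (F i) i := fun k i hki =>
    Set.nsmul_subset_nsmul_right (hB0 (F i) i) hki
  refine ⟨fun m => ⋃ i ≥ m, B (F i) i, ⟨?_, ?_, ?_, ?_⟩, ?_, ?_⟩
  · intro m l hml x hx
    simp only [Set.mem_iUnion] at hx ⊢
    obtain ⟨i, hi, hx⟩ := hx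
    exact ⟨i, hml.trans hi, hx⟩
  · intro m
    exact Set.mem_iUnion₂.2 ⟨m, le_rfl, hB0 _ _⟩
  · intro m x hx
    obtain ⟨i, hi, hx⟩ := Set.mem_iUnion₂.1 hx
    exact Set.mem_iUnion₂.2 ⟨i, hi, hBneg _ _ x hx⟩
  · intro m l
    refine ((Set.finite_lt_nat l).biUnion fun i _ => hBfin (F i) i).subset ?_
    rintro x ⟨hx, hxl⟩
    obtain ⟨i, hi, hx⟩ := Set.mem_iUnion₂.1 hx
    refine Set.mem_iUnion₂.2 ⟨i, ?_, hx⟩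
    by_contra hil
    exact hxl (Set.mem_iUnion₂.2 ⟨i, not_lt.1 hil, hx⟩)
  · intro k g hg
    -- Then `g` lies in `F (n + 1)`, and blocks from `n + 1` on have index at least `k`, so sums of
    -- `k` of their terms count as short.
    obtain ⟨n, hn, hgn⟩ := he g k
    refine ⟨n + 1, fun hmem => hg ?_⟩
    obtain ⟨s, f, hs, hf, -, rfl⟩ :=
      exists_sum_of_mem_nsmul_iUnion (fun i => hB0 (F i) i) (n + 1) k g hmem
    refine sum_eq_zero_of_mem hFmono (fun i => ?_) (n + 1) (fun i hi hfi => ?_) s hs ?_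
    · have : ∀ k : ℕ, k • B (F i) i ⊆ (F (i + 1)).1 := by
        intro k
        induction k with
        | zero => simp
        | succ k ih =>
          rw [succ_nsmul]
          rintro _ ⟨x, hx, y, hy, rfl⟩
          exact add_mem (ih hx) (hB_sub (F i) i hy)
      exact this k (hf i)
    · exact hBF (F i) i _ (hmono k i (by omega) (hf i)) hfi
    · rw [← hgn]
      exact he_mem (F n) n
  · intro χ hχ g
    have hsmall : ∀ ε > 0, ‖(χ g : ℂ) - 1‖ ≤ ε := by
      intro ε hε
      obtain ⟨m, hm⟩ := hχ (min (ε / 4) (1 / 2)) (by positivity)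
      obtain ⟨n, hn, rfl⟩ := he g m
      have := hBχ (F n) n χ (min (ε / 4) (1 / 2)) (min_le_right _ _)
        fun x hx => (hm x (Set.mem_iUnion₂.2 ⟨n, hn, hx⟩)).le
      have := min_le_left (ε / 4) (1 / 2)
      linarith
    have hzero : ‖(χ g : ℂ) - 1‖ = 0 :=
      le_antisymm (le_of_forall_pos_le_add (by simpa using hsmall)) (norm_nonneg _)
    rw [norm_eq_zero, sub_eq_zero] at hzero
    exact Circle.ext hzero

end Blocks

theorem corollary1 (G : Type*) [AddCommGroup G] [Countable G] [Infinite G]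
    (htors : IsAddTorsion G) (hunb : AddMonoid.exponent G = 0) :
    ∃ (τ : TopologicalSpace G) (_ : IsTopologicalAddGroup G),
      T2Space G ∧ IsCompleteTopAddGroup G ∧ IsMinAP G := by
  obtain ⟨E, hE, hsep, hχ⟩ := exists_isTailSystem_forall_addChar_eq_one htors hunb
  obtain ⟨τ, hτ, hT2, hcomplete, htail⟩ := hE.exists_complete_topology hsep
  refine ⟨τ, hτ, hT2, hcomplete, ?_⟩
  refine (AddSubgroup.eq_top_iff' _).2 fun g χ hcont => hχ χ (fun ε hε => ?_) g
  have hc : Continuous fun x => ‖(χ x : ℂ) - 1‖ := by fun_prop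
  refine htail {x | ‖(χ x : ℂ) - 1‖ < ε} (hc.continuousAt.eventually_lt_const ?_)
  simpa using hε
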